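/- All manifolds are smooth, real, finite-dimensional, without boundary, Hausdorff, paracompact and separable. A Dirac structure on a manifold $M$ is a smooth vector subbundle $L \subset TM \oplus T^*M$ that is maximally isotropic for the pairing $\langle X+\alpha, Y+\beta\rangle_+ = \tfrac12(\alpha(Y)+\beta(X))$ and whose sections are closed under the Dorfman bracket $[\![X+\alpha, Y+\beta]\!] = [X,Y] + \mathcal{L}_X\beta - \iota_Y d\alpha$. A function $f \in C^\infty(M)$ is an $L$-Hamiltonian function for a smooth vector field $X$ if $X + df$ is a section of $L$; such functions $f$ are called admissible, they form the space $\mathrm{Adm}(M,L)$, and $\{f,g\}_L := -Xg$, for $f,g\in\mathrm{Adm}(M,L)$ and any $X$ having $f$ as $L$-Hamiltonian function, is its Poisson bracket. Let $\mathfrak{g}$ be a finite-dimensional real Lie algebra, and equip $C^\infty(\mathfrak{g}^*)$ with the bracket $\{f,g\}(\xi) = \langle \xi, [df_\xi, dg_\xi]\rangle$. Let $C \in C^\infty(\mathfrak{g}^*)$ be a Casimir function, that is, $\{C,f\}=0$ for all $f \in C^\infty(\mathfrak{g}^*)$. For $i = 1,\dots,k$ let $(M_i, L_i)$ be a Dirac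 manifold and let $\phi_i : \mathfrak{g} \to \mathrm{Adm}(M_i,L_i)$ be a morphism of Lie algebras (an infinitesimal $L_i$-Hamiltonian action), with momentum map $\mathbf{J}_{\phi_i} : M_i \to \mathfrak{g}^*$, $\langle \mathbf{J}_{\phi_i}(x), v\rangle = \phi_i(v)(x)$. Let $L_1\times\cdots\times L_k$ be the direct product Dirac structure on $M_1\times\cdots\times M_k$, let $\lambda(f_1,\dots,f_k) = \mathrm{pr}_1^*f_1 + \cdots + \mathrm{pr}_k^*f_k$ for functions $f_i$ on $M_i$, and let $\Delta^{[k]}(C)(\xi_1,\dots,\xi_k) = C(\xi_1+\cdots+\xi_k)$. Put $$F := (\mathbf{J}_{\phi_1}\times\cdots\times\mathbf{J}_{\phi_k})^*\big[\Delta^{[k]}(C)\big], \qquad F(x_1,\dots,x_k) = C\big(\mathbf{J}_{\phi_1}(x_1)+\cdots+\mathbf{J}_{\phi_k}(x_k)\big).$$ Then $F$ is an admissible function of $(M_1\times\cdots\times M_k, L_1\times\cdots\times L_k)$ and, for every $v \in \mathfrak{g}$, so is $\lambda(\phi_1(v),\dots,\phi_k(v))$, and $$\big\{F, \lambda(\phi_1(v),\dots,\phi_k(v))\big\}_{L_1\times\cdots\times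 L_k} = 0 .$$ Moreover, for every $v\in\mathfrak{g}$ and all vector fields $X_{\phi_i(v)}$ on $M_i$ having $\phi_i(v)$ as $L_i$-Hamiltonian function, $F$ is a constant of motion of the direct product $X_{\phi_1(v)}\times\cdots\times X_{\phi_k(v)}$, that is, $F$ is smooth and $(X_{\phi_1(v)}\times\cdots\times X_{\phi_k(v)})F = 0$. -/

import Mathlib

open Set Bundle Topology
open scoped Manifold ContDiff

noncomputable section

namespace DiracGeom

/-! ### Finite products of manifolds -/

section Product

variable {ι : Type*} [Fintype ι] {E : ι → Type*} [∀ i, NormedAddCommGroup (E i)]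
  [∀ i, NormedSpace ℝ (E i)] {H : ι → Type*} [∀ i, TopologicalSpace (H i)]

/-- A finite product of transition maps of class `C^n` is of class `C^n`. -/
theorem contDiffGroupoid_pi {n : ℕ∞ω} (I : ∀ i, ModelWithCorners ℝ (E i) (H i))
    {e : ∀ i, OpenPartialHomeomorph (H i) (H i)} (he : ∀ i, e i ∈ contDiffGroupoid n (I i)) :
    (OpenPartialHomeomorph.pi e : OpenPartialHomeomorph (ModelPi H) (ModelPi H)) ∈
      contDiffGroupoid n (ModelWithCorners.pi I) := by
  have key : ∀ (f : ∀ i, OpenPartialHomeomorph (H i) (H i)),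
      (∀ i, ContDiffOn ℝ n (I i ∘ f i ∘ (I i).symm) ((I i).symm ⁻¹' (f i).source ∩ range (I i))) →
      ContDiffOn ℝ n (fun (x : ∀ i, E i) i => (I i) ((f i) ((I i).symm (x i))))
        ((ModelWithCorners.pi I).symm ⁻¹' (OpenPartialHomeomorph.pi f).source
          ∩ range (ModelWithCorners.pi I)) := by
    intro f hf
    rw [contDiffOn_pi]
    intro i
    refine (hf i).comp (t := (I i).symm ⁻¹' (f i).source ∩ range (I i))
      (ContinuousLinearMap.proj (R := ℝ) (φ := E) i).contDiff.contDiffOn ?_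
    rintro x ⟨hx, y, rfl⟩
    exact ⟨hx i (mem_univ i), mem_range_self (y i)⟩
  exact ⟨key e fun i => (he i).1, key (fun i => (e i).symm) fun i => (he i).2⟩

/-- A finite product of `C^n` manifolds is a `C^n` manifold. -/
instance isManifold_pi {n : ℕ∞ω} (I : ∀ i, ModelWithCorners ℝ (E i) (H i))
    {M : ι → Type*} [∀ i, TopologicalSpace (M i)] [∀ i, ChartedSpace (H i) (M i)]
    [∀ i, IsManifold (I i) n (M i)] : IsManifold (ModelWithCorners.pi I) n (∀ i, M i) where
  compatible := by
    rintro _ _ ⟨f, hf, rfl⟩ ⟨g, hg, rfl⟩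
    have h := contDiffGroupoid_pi I (n := n) (e := fun i => (f i).symm.trans (g i))
      fun i => (contDiffGroupoid n (I i)).compatible (hf i (mem_univ i)) (hg i (mem_univ i))
    refine (contDiffGroupoid n (ModelWithCorners.pi I)).mem_of_eqOnSource h ?_
    refine ⟨?_, fun x _ => rfl⟩
    ext x
    change (x ∈ (univ.pi fun i => (f i).target) ∧ (fun i => (f i).symm (x i)) ∈
      (univ.pi fun i => (g i).source)) ↔ x ∈ univ.pi fun i => ((f i).symm.trans (g i)).source
    exact ⟨fun h i hi => ⟨h.1 i hi, h.2 i hi⟩,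
      fun h => ⟨fun i hi => (h i hi).1, fun i hi => (h i hi).2⟩⟩

end Product

/-! ### Vector fields, one-forms and the Dorfman bracket -/

section Calculus

variable {E : Type*} [NormedAddCommGroup E] [NormedSpace ℝ E] {H : Type*} [TopologicalSpace H]
  (I : ModelWithCorners ℝ E H) {M : Type*} [TopologicalSpace M] [ChartedSpace H M]

/-- The cotangent space `T_x^* M`. -/
abbrev Cotangent (x : M) : Type _ := TangentSpace I x →L[ℝ] ℝ

/-- The fibre `T_x M ⊕ T_x^* M` of the generalised tangent bundle. -/
abbrev GenTangent (x : M) : Type _ := TangentSpace I x × Cotangent I x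

/-- The differential of a real function, as a one-form. -/
def differential (f : M → ℝ) (x : M) : Cotangent I x := mfderiv I 𝓘(ℝ, ℝ) f x

/-- Smoothness of a vector field on a set. -/
def SmoothVectorFieldOn [IsManifold I ∞ M] (X : ∀ x : M, TangentSpace I x) (s : Set M) : Prop :=
  ContMDiffOn I I.tangent ∞ (fun x => (⟨x, X x⟩ : TangentBundle I M)) s

/-- Smoothness of a one-form on a set, as a section of the bundle `Hom(TM, ℝ)`. -/
def SmoothOneFormOn [IsManifold I ∞ M] (α : ∀ x : M, Cotangent I x) (s : Set M) : Prop :=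
  ContMDiffOn I (I.prod 𝓘(ℝ, E →L[ℝ] ℝ)) ∞
    (fun x => TotalSpace.mk' (E →L[ℝ] ℝ)
      (E := fun x : M => TangentSpace I x →L[ℝ] Bundle.Trivial M ℝ x) x (α x)) s

/-- The local representative, in the preferred chart at `p`, of a one-form. -/
def chartForm (α : ∀ x : M, Cotangent I x) (p : M) (y : E) : E →L[ℝ] ℝ :=
  (α ((extChartAt I p).symm y)).comp
    (mfderivWithin 𝓘(ℝ, E) I (extChartAt I p).symm (range I) y)

/-- The contraction `ι_v dα` at `p`: if `a` is the representative of `α` in the preferred chart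
at `p`, which is the chart that identifies `T_p M` with `E`, then
`dα (v, w) = (D_v a) w - (D_w a) v`. -/
def contractExtDeriv (α : ∀ x : M, Cotangent I x) (p : M) (v : TangentSpace I p) :
    Cotangent I p :=
  let D : E →L[ℝ] E →L[ℝ] ℝ := fderivWithin ℝ (chartForm I α p) (range I) (extChartAt I p p)
  (D v - D.flip v : E →L[ℝ] ℝ)

/-- The Lie derivative of a one-form, `ℒ_X β = d (ι_X β) + ι_X dβ`. -/
def lieDerivForm (X : ∀ x : M, TangentSpace I x) (β : ∀ x : M, Cotangent I x) (x : M) :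
    Cotangent I x :=
  differential I (fun y => β y (X y)) x + contractExtDeriv I β x (X x)

/-- The Dorfman bracket `⟦X + α, Y + β⟧ = [X, Y] + ℒ_X β - ι_Y dα`. -/
def dorfman (e e' : ∀ x : M, GenTangent I x) (x : M) : GenTangent I x :=
  (VectorField.mlieBracket I (fun y => (e y).1) (fun y => (e' y).1) x,
    lieDerivForm I (fun y => (e y).1) (fun y => (e' y).2) x
      - contractExtDeriv I (fun y => (e y).2) x (e' x).1)

end Calculus

/-! ### Dirac structures, admissible functions and their Poisson bracket -/

section Dirac

variable {E : Type*} [NormedAddCommGroup E] [NormedSpace ℝ E] {H : Type*} [TopologicalSpace H]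
  {I : ModelWithCorners ℝ E H} {M : Type*} [TopologicalSpace M] [ChartedSpace H M]

/-- The symmetric pairing `⟨X + α, Y + β⟩₊ = (α(Y) + β(X)) / 2`. -/
def pairing {x : M} (e e' : GenTangent I x) : ℝ := (1 / 2) * (e.2 e'.1 + e'.2 e.1)

/-- Isotropy of a subspace of `T_x M ⊕ T_x^* M`. -/
def IsIsotropic {x : M} (W : Submodule ℝ (GenTangent I x)) : Prop :=
  ∀ e ∈ W, ∀ e' ∈ W, pairing e e' = 0

variable [IsManifold I ∞ M]

/-- A smooth section of `TM ⊕ T^*M` on a set. -/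
def SmoothSectionOn (e : ∀ x : M, GenTangent I x) (s : Set M) : Prop :=
  SmoothVectorFieldOn I (fun x => (e x).1) s ∧ SmoothOneFormOn I (fun x => (e x).2) s

/-- A Dirac structure on `M`: a smooth vector subbundle `L` of `TM ⊕ T^*M` that is maximally
isotropic and whose sections are closed under the Dorfman bracket. -/
structure IsDirac (L : ∀ x : M, Submodule ℝ (GenTangent I x)) : Prop where
  exists_frame : ∀ p : M, ∃ U ∈ 𝓝 p, ∃ (n : ℕ) (e : Fin n → ∀ x : M, GenTangent I x),
    (∀ j, SmoothSectionOn (e j) U) ∧ ∀ x ∈ U, LinearIndependent ℝ (fun j => e j x) ∧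
      Submodule.span ℝ (range fun j => e j x) = L x
  maximal_isotropic : ∀ x : M, Maximal IsIsotropic (L x)
  involutive : ∀ e e' : ∀ x : M, GenTangent I x, SmoothSectionOn e univ → SmoothSectionOn e' univ →
    (∀ x, e x ∈ L x) → (∀ x, e' x ∈ L x) → ∀ x, dorfman I e e' x ∈ L x

/-- `f` is an `L`-Hamiltonian function for the vector field `X`: both are smooth and
`X + df` is a section of `L`. -/
def IsHamiltonian (L : ∀ x : M, Submodule ℝ (GenTangent I x)) (X : ∀ x : M, TangentSpace I x)
    (f : M → ℝ) : Prop :=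
  SmoothVectorFieldOn I X univ ∧ ContMDiff I 𝓘(ℝ, ℝ) ∞ f ∧ ∀ x, (X x, differential I f x) ∈ L x

/-- The set of admissible functions of `(M, L)`. -/
def Adm (L : ∀ x : M, Submodule ℝ (GenTangent I x)) : Set (M → ℝ) :=
  {f | ∃ X, IsHamiltonian L X f}

open Classical in
/-- The Poisson bracket `{f, g} = -X g` of admissible functions, where `X` is an `L`-Hamiltonian
vector field for `f`. -/
def poissonBracket (L : ∀ x : M, Submodule ℝ (GenTangent I x)) (f g : M → ℝ) : M → ℝ :=
  if h : f ∈ Adm L then fun x => -(differential I g x (h.choose x)) else 0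

/-- The Poisson bracket does not depend on the chosen Hamiltonian vector field. -/
theorem poissonBracket_eq {L : ∀ x : M, Submodule ℝ (GenTangent I x)}
    (hL : ∀ x, IsIsotropic (L x)) {f g : M → ℝ} {X : ∀ x : M, TangentSpace I x}
    (hX : IsHamiltonian L X f) (hg : g ∈ Adm L) (x : M) :
    poissonBracket L f g x = -(differential I g x (X x)) := by
  have hf : f ∈ Adm L := ⟨X, hX⟩
  obtain ⟨Y, hY⟩ := hg
  have h1 := hL x _ (hX.2.2 x) _ (hY.2.2 x)
  have h2 := hL x _ (hf.choose_spec.2.2 x) _ (hY.2.2 x)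
  simp only [pairing] at h1 h2
  simp only [poissonBracket, dif_pos hf]
  linarith

/-- `F` is a (`t`-independent) constant of motion of the vector field `X`: it is smooth and
`X F = 0`. -/
def IsConstantOfMotion (X : ∀ x : M, TangentSpace I x) (F : M → ℝ) : Prop :=
  ContMDiff I 𝓘(ℝ, ℝ) ∞ F ∧ ∀ x, differential I F x (X x) = 0

/-- An infinitesimal `L`-Hamiltonian action of a Lie algebra `𝔤` on `(M, L)`: a morphism of
Lie algebras from `𝔤` to the admissible functions. -/
structure HamiltonianAction (𝔤 : Type*) [LieRing 𝔤] [LieAlgebra ℝ 𝔤]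
    (L : ∀ x : M, Submodule ℝ (GenTangent I x)) where
  toLinearMap : 𝔤 →ₗ[ℝ] (M → ℝ)
  mem_adm : ∀ v, toLinearMap v ∈ Adm L
  map_lie : ∀ v w, toLinearMap ⁅v, w⁆ = poissonBracket L (toLinearMap v) (toLinearMap w)

/-- The momentum map `⟨J(x), v⟩ = φ(v)(x)`. -/
def HamiltonianAction.momentum {𝔤 : Type*} [LieRing 𝔤] [LieAlgebra ℝ 𝔤]
    {L : ∀ x : M, Submodule ℝ (GenTangent I x)} (φ : HamiltonianAction 𝔤 L) (x : M) :
    Module.Dual ℝ 𝔤 :=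
  (LinearMap.proj x).comp φ.toLinearMap

end Dirac

/-! ### Direct products -/

section DirectProduct

variable {ι : Type*} [Fintype ι] {E : ι → Type*} [∀ i, NormedAddCommGroup (E i)]
  [∀ i, NormedSpace ℝ (E i)] {H : ι → Type*} [∀ i, TopologicalSpace (H i)]
  {I : ∀ i, ModelWithCorners ℝ (E i) (H i)} {M : ι → Type*} [∀ i, TopologicalSpace (M i)]
  [∀ i, ChartedSpace (H i) (M i)]

/-- The direct product `λ(f₁, …, f_k) = pr₁^* f₁ + ⋯ + pr_k^* f_k` of functions. -/
def prodFun (f : ∀ i, M i → ℝ) (x : ∀ i, M i) : ℝ := ∑ i, f i (x i)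

/-- The direct product `X₁ × ⋯ × X_k` of vector fields, under the identification of the tangent
space of the product with the product of the tangent spaces. -/
def prodVectorField (X : ∀ i, ∀ x : M i, TangentSpace (I i) x) (x : ∀ i, M i) :
    TangentSpace (ModelWithCorners.pi I) x :=
  (fun i => X i (x i) : ∀ i, E i)

/-- The component at `i` of a tangent vector to the product. -/
def tangentProj (x : ∀ i, M i) (i : ι) :
    TangentSpace (ModelWithCorners.pi I) x →L[ℝ] TangentSpace (I i) (x i) :=
  (ContinuousLinearMap.proj i : (∀ i, E i) →L[ℝ] E i)

open Classical in
/-- The inclusion of `T_{x_i} M_i` as the `i`-th summand of the tangent space of the product. -/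
def tangentIncl (x : ∀ i, M i) (i : ι) :
    TangentSpace (I i) (x i) →L[ℝ] TangentSpace (ModelWithCorners.pi I) x :=
  (ContinuousLinearMap.single ℝ E i : E i →L[ℝ] (∀ i, E i))

/-- `tangentProj x i` is the tangent map of the `i`-th projection. -/
theorem hasMFDerivAt_proj (x : ∀ i, M i) (i : ι) :
    HasMFDerivAt (ModelWithCorners.pi I) (I i) (fun y : ∀ i, M i => y i) x (tangentProj x i) := by
  refine ⟨(continuous_apply i).continuousAt, ?_⟩
  have h : HasFDerivWithinAt (fun y : ∀ i, E i => y i)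
      (ContinuousLinearMap.proj i : (∀ i, E i) →L[ℝ] E i) (range (ModelWithCorners.pi I))
      (extChartAt (ModelWithCorners.pi I) x x) :=
    (ContinuousLinearMap.proj i : (∀ i, E i) →L[ℝ] E i).hasFDerivWithinAt
  refine h.congr_of_eventuallyEq ?_ ?_
  · filter_upwards [extChartAt_target_mem_nhdsWithin (I := ModelWithCorners.pi I) x] with y hy
    exact (extChartAt (I i) (x i)).right_inv ⟨hy.1 i (mem_univ i), hy.2 i (mem_univ i)⟩
  · exact (extChartAt (I i) (x i)).right_inv ((extChartAt (I i) (x i)).map_source (mem_extChartAt_source (x i)))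

/-- The direct product `L₁ × ⋯ × L_k`: at `(x₁, …, x_k)` it consists of the `X + α` whose
components `X_i + α_i` lie in the fibre of `L_i` at `x_i`. -/
def prodDirac (L : ∀ i, ∀ x : M i, Submodule ℝ (GenTangent (I i) x)) (x : ∀ i, M i) :
    Submodule ℝ (GenTangent (ModelWithCorners.pi I) x) where
  carrier := {e | ∀ i, (tangentProj x i e.1, e.2.comp (tangentIncl x i)) ∈ L i (x i)}
  add_mem' := fun {a b} ha hb i => by
    have := (L i (x i)).add_mem (ha i) (hb i)
    simpa using this
  zero_mem' := fun i => by
    rw [Prod.fst_zero, Prod.snd_zero, map_zero, ContinuousLinearMap.zero_comp]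
    exact (L i (x i)).zero_mem
  smul_mem' := fun c a ha i => by
    have := (L i (x i)).smul_mem c (ha i)
    simpa using this

/-- A direct product of isotropic subbundles is isotropic. -/
theorem prodDirac_isIsotropic {L : ∀ i, ∀ x : M i, Submodule ℝ (GenTangent (I i) x)}
    (hL : ∀ i x, IsIsotropic (L i x)) (x : ∀ i, M i) : IsIsotropic (prodDirac L x) := by
  classical
  have key : ∀ (α : Cotangent (ModelWithCorners.pi I) x)
      (v : TangentSpace (ModelWithCorners.pi I) x),
      α v = ∑ i, (α.comp (tangentIncl x i)) (tangentProj x i v) := by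
    intro α v
    have h : v = ∑ i, tangentIncl x i (tangentProj x i v) :=
      (Finset.univ_sum_single (M := E) v).symm
    conv_lhs => rw [h, map_sum]
    rfl
  intro e he e' he'
  have h := Finset.sum_congr rfl fun i (_ : i ∈ Finset.univ) => hL i (x i) _ (he i) _ (he' i)
  simp only [pairing, ← Finset.mul_sum, Finset.sum_add_distrib, Finset.sum_const_zero] at h
  rw [pairing, key e.2, key e'.2]
  exact h

end DirectProduct

/-! ### Smooth functions on the dual of a Lie algebra -/

section Dual

variable {𝔤 : Type*} [LieRing 𝔤] [LieAlgebra ℝ 𝔤] [FiniteDimensional ℝ 𝔤]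

/-- The linear coordinates on `𝔤^*` given by a basis of `𝔤`. -/
def dualCoords (𝔤 : Type*) [LieRing 𝔤] [LieAlgebra ℝ 𝔤] [FiniteDimensional ℝ 𝔤] :
    (Fin (Module.finrank ℝ 𝔤) → ℝ) ≃ₗ[ℝ] Module.Dual ℝ 𝔤 :=
  (Module.finBasis ℝ 𝔤).dualBasis.equivFun.symm

/-- Smoothness of a function on `𝔤^*`, expressed in linear coordinates. -/
def SmoothOnDual (f : Module.Dual ℝ 𝔤 → ℝ) : Prop :=
  ContDiff ℝ ∞ fun c => f (dualCoords 𝔤 c)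

/-- The differential of `f` at `ξ`, as an element of `𝔤`. -/
def dualDiff (f : Module.Dual ℝ 𝔤 → ℝ) (ξ : Module.Dual ℝ 𝔤) : 𝔤 :=
  ∑ i, lineDeriv ℝ f ξ ((Module.finBasis ℝ 𝔤).coord i) • Module.finBasis ℝ 𝔤 i

/-- The element `dualDiff f ξ` of `𝔤` represents the differential of `f` at `ξ`. -/
theorem dualDiff_spec {f : Module.Dual ℝ 𝔤 → ℝ} (hf : SmoothOnDual f) (ξ η : Module.Dual ℝ 𝔤) :
    η (dualDiff f ξ) = lineDeriv ℝ f ξ η := by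
  let F : (Fin (Module.finrank ℝ 𝔤) → ℝ) → ℝ := fun c => f (dualCoords 𝔤 c)
  have hline : ∀ ζ, lineDeriv ℝ f ξ ζ =
      fderiv ℝ F ((dualCoords 𝔤).symm ξ) ((dualCoords 𝔤).symm ζ) := by
    intro ζ
    rw [← (hf.differentiable (by simp) _).lineDeriv_eq_fderiv]
    simp [lineDeriv]
  have hη : η = ∑ i, η (Module.finBasis ℝ 𝔤 i) • (Module.finBasis ℝ 𝔤).coord i := by
    refine (Module.finBasis ℝ 𝔤).ext fun j => ?_
    simp
  conv_rhs => rw [hη, hline, map_sum, map_sum]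
  simp only [dualDiff, map_sum, map_smul, smul_eq_mul, hline]
  exact Finset.sum_congr rfl fun i _ => mul_comm _ _

/-- The Kirillov-Kostant-Souriau bracket `{f, g}(ξ) = ⟨ξ, [df_ξ, dg_ξ]⟩`. -/
def kks (f g : Module.Dual ℝ 𝔤 → ℝ) (ξ : Module.Dual ℝ 𝔤) : ℝ :=
  ξ ⁅dualDiff f ξ, dualDiff g ξ⁆

/-- A Casimir function of `𝔤^*`: a smooth function whose KKS bracket with every smooth function
vanishes. -/
def IsCasimir (C : Module.Dual ℝ 𝔤 → ℝ) : Prop :=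
  SmoothOnDual C ∧ ∀ f : Module.Dual ℝ 𝔤 → ℝ, SmoothOnDual f → kks C f = 0

end Dual

/-! ### The higher-order coproducts -/

section Coproduct

variable {𝔤 : Type*} [LieRing 𝔤] [LieAlgebra ℝ 𝔤]

/-- The `k`-th order coproduct `Δ^[k] f`, the pull-back of `f` along the `k`-fold addition map
`m^[k] : (𝔤^*)^k → 𝔤^*`. -/
def coproduct (k : ℕ) (f : Module.Dual ℝ 𝔤 → ℝ) (ξ : Fin k → Module.Dual ℝ 𝔤) : ℝ :=
  f (∑ i, ξ i)

theorem coproduct_two (f : Module.Dual ℝ 𝔤 → ℝ) (ξ : Fin 2 → Module.Dual ℝ 𝔤) :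
    coproduct 2 f ξ = f (ξ 0 + ξ 1) := by
  simp [coproduct]

/-- The recursion `Δ^[k+1] = (id^(k-1) ⊗ Δ) ∘ Δ^[k]`, written with `k = n + 1`. -/
theorem coproduct_succ (n : ℕ) (f : Module.Dual ℝ 𝔤 → ℝ) (ξ : Fin (n + 2) → Module.Dual ℝ 𝔤) :
    coproduct (n + 2) f ξ = coproduct (n + 1) f
      (Fin.snoc (α := fun _ => Module.Dual ℝ 𝔤) (fun i : Fin n => ξ i.castSucc.castSucc)
        (ξ (Fin.last n).castSucc + ξ (Fin.last (n + 1)))) := by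
  simp [coproduct, Fin.sum_univ_castSucc, add_assoc]

end Coproduct

end DiracGeom

end

namespace DiracGeom

/-! `F` is a collective function `C ∘ J`, where `J = ∑ i, J_i ∘ pr_i` is the momentum map of the
diagonal action. Its component along `v` is `λ(φ₁(v), …, φ_k(v))`, with the product of Hamiltonian
fields of the factors as Hamiltonian field (`IsHamiltonian.prod`).

At a point `x`, with `w = dC` at `J x` held fixed, the chain rule gives `dF = d⟨J, w⟩`
(`differential_comp_dual`). Expanding `w` in a basis writes `dF` as a combination, with smooth
coefficients, of differentials that already have Hamiltonian fields. The same combination of fields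
is Hamiltonian for `F`, since the fibres of `L` are linear subspaces (`IsHamiltonian.comp_dual`).

If `Y` is a product of Hamiltonian fields of the `φ_i(v)`, then `Y F` at `x` is `Y⟨J, w⟩ = -⟨J x,
[v, w]⟩`, because each `φ_i` is a Lie morphism. This vanishes because `C` Poisson-commutes with the
linear function `ξ ↦ ξ v` (`IsCasimir.apply_lie_eq_zero`). Isotropy of the product turns `Y F = 0`
into the vanishing of the bracket. -/

/-- `HasMFDerivAt.sum` for index types in any universe. -/
theorem hasMFDerivAt_sum {E : Type*} [NormedAddCommGroup E] [NormedSpace ℝ E] {H : Type*}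
    [TopologicalSpace H] {I : ModelWithCorners ℝ E H} {M : Type*} [TopologicalSpace M]
    [ChartedSpace H M] {ι : Type*} (t : Finset ι) {f : ι → M → ℝ} {x : M} {f' : ι → Cotangent I x}
    (hf : ∀ i, HasMFDerivAt I 𝓘(ℝ, ℝ) (f i) x (f' i)) :
    HasMFDerivAt I 𝓘(ℝ, ℝ) (∑ i ∈ t, f i) x (∑ i ∈ t, f' i : Cotangent I x) := by
  classical
  induction t using Finset.induction_on with
  | empty => exact hasMFDerivAt_const (0 : ℝ) x
  | insert i s hi IH =>
    rw [Finset.sum_insert hi, Finset.sum_insert hi]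
    exact (hf i).add IH

/-! ### Calculus and Hamiltonian functions on direct products. -/

section DirectProduct

variable {ι : Type*} [Fintype ι] {E : ι → Type*} [∀ i, NormedAddCommGroup (E i)]
  [∀ i, NormedSpace ℝ (E i)] {H : ι → Type*} [∀ i, TopologicalSpace (H i)]
  {I : ∀ i, ModelWithCorners ℝ (E i) (H i)} {M : ι → Type*} [∀ i, TopologicalSpace (M i)]
  [∀ i, ChartedSpace (H i) (M i)]

/-- The projections of a finite product of manifolds are of class `C^n`. -/
theorem contMDiff_pi_proj {n : ℕ∞ω} (i : ι) :
    ContMDiff (ModelWithCorners.pi I) (I i) n (fun y : ∀ i, M i => y i) := by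
  intro x
  rw [contMDiffAt_iff]
  refine ⟨(continuous_apply i).continuousAt, ?_⟩
  have h : ContDiffWithinAt ℝ n (fun y : ∀ i, E i => y i) (range (ModelWithCorners.pi I))
      (extChartAt (ModelWithCorners.pi I) x x) :=
    (ContinuousLinearMap.proj i : (∀ i, E i) →L[ℝ] E i).contDiff.contDiffWithinAt
  refine h.congr_of_eventuallyEq ?_ ?_
  · filter_upwards [extChartAt_target_mem_nhdsWithin (I := ModelWithCorners.pi I) x] with y hy
    exact (extChartAt (I i) (x i)).right_inv ⟨hy.1 i (mem_univ i), hy.2 i (mem_univ i)⟩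
  · exact (extChartAt (I i) (x i)).right_inv
      ((extChartAt (I i) (x i)).map_source (mem_extChartAt_source (x i)))

/-- The coordinate changes of the tangent bundle of a product are computed componentwise. -/
theorem tangentCoordChange_pi [∀ i, IsManifold (I i) 1 (M i)] {x y z : ∀ i, M i}
    (h : z ∈ (extChartAt (ModelWithCorners.pi I) x).source ∩
      (extChartAt (ModelWithCorners.pi I) y).source) (v : ∀ i, E i) (i : ι) :
    tangentCoordChange (ModelWithCorners.pi I) x y z v i =
      tangentCoordChange (I i) (x i) (y i) (z i) (v i) := by
  have h1 := hasFDerivWithinAt_pi'.1 (hasFDerivWithinAt_tangentCoordChange h) i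
  have hz : z i ∈ (extChartAt (I i) (x i)).source ∩ (extChartAt (I i) (y i)).source := by
    rw [extChartAt_source, extChartAt_source] at h ⊢
    exact ⟨h.1 i (mem_univ i), h.2 i (mem_univ i)⟩
  have h2 : HasFDerivWithinAt (fun w : ∀ i, E i => w i)
      (ContinuousLinearMap.proj i : (∀ i, E i) →L[ℝ] E i) (range (ModelWithCorners.pi I))
      (extChartAt (ModelWithCorners.pi I) x z) :=
    (ContinuousLinearMap.proj i : (∀ i, E i) →L[ℝ] E i).hasFDerivWithinAt
  have h3 := (hasFDerivWithinAt_tangentCoordChange hz).comp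
    (extChartAt (ModelWithCorners.pi I) x z) h2 (by
      rintro _ ⟨w, rfl⟩
      exact mem_range_self (w i))
  -- `h1` and `h3` differentiate the same function: component `i` of the product's transition map is
  -- the factor's transition map after the linear projection. Unique differentiability then
  -- identifies the derivatives.
  have hu : UniqueDiffWithinAt ℝ (range (ModelWithCorners.pi I))
      (extChartAt (ModelWithCorners.pi I) x z) :=
    (ModelWithCorners.pi I).uniqueDiffOn _ (mem_range_self _)
  exact congrArg (fun D : (∀ i, E i) →L[ℝ] E i => D v) (hu.eq h1 h3)

/-- A direct product of smooth vector fields is smooth. -/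
theorem smoothVectorFieldOn_prodVectorField [∀ i, IsManifold (I i) ∞ (M i)]
    {X : ∀ i, ∀ x : M i, TangentSpace (I i) x} (hX : ∀ i, SmoothVectorFieldOn (I i) (X i) univ) :
    SmoothVectorFieldOn (ModelWithCorners.pi I) (prodVectorField X) univ := by
  have _ (i) : IsManifold (I i) 1 (M i) := .of_le (n := ∞) (by simp)
  rw [SmoothVectorFieldOn, contMDiffOn_univ]
  intro x
  refine (contMDiffAt_section (IB := ModelWithCorners.pi I) (F := ∀ i, E i)
    (E := TangentSpace (ModelWithCorners.pi I) (M := ∀ i, M i)) x).2 ?_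
  rw [contMDiffAt_pi_space]
  intro i
  have hi := hX i
  rw [SmoothVectorFieldOn, contMDiffOn_univ] at hi
  have h1 := (contMDiffAt_section (IB := I i) (F := E i)
    (E := TangentSpace (I i) (M := M i)) (x i)).1 (hi (x i))
  refine (h1.comp x (contMDiff_pi_proj (I := I) i x)).congr_of_eventuallyEq ?_
  -- In the trivialisation at `x`, the vector at `y` is read through the coordinate change from the
  -- chart at `y` to the chart at `x`, so smoothness reduces to the factors.
  filter_upwards [extChartAt_source_mem_nhds (I := ModelWithCorners.pi I) x] with y hy
  exact tangentCoordChange_pi ⟨mem_extChartAt_source y, hy⟩ _ i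

theorem contMDiff_prodFun {n : ℕ∞ω} {f : ∀ i, M i → ℝ} (hf : ∀ i, ContMDiff (I i) 𝓘(ℝ, ℝ) n (f i)) :
    ContMDiff (ModelWithCorners.pi I) 𝓘(ℝ, ℝ) n (prodFun f) :=
  contMDiff_finsetSum fun i _ => (hf i).comp (contMDiff_pi_proj i)

theorem differential_prodFun {f : ∀ i, M i → ℝ} {x : ∀ i, M i}
    (hf : ∀ i, MDifferentiableAt (I i) 𝓘(ℝ, ℝ) (f i) (x i)) :
    differential (ModelWithCorners.pi I) (prodFun f) x =
      ∑ i, (differential (I i) (f i) (x i)).comp (tangentProj x i) := by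
  have hc (i : ι) : HasMFDerivAt (ModelWithCorners.pi I) 𝓘(ℝ, ℝ) (f i ∘ fun y : ∀ i, M i => y i) x
      ((differential (I i) (f i) (x i)).comp (tangentProj x i)) :=
    HasMFDerivAt.comp x (hf i).hasMFDerivAt (hasMFDerivAt_proj x i)
  have h := hasMFDerivAt_sum Finset.univ hc
  have e : (∑ i, f i ∘ fun y : ∀ i, M i => y i) = prodFun f := by
    ext y
    simp [prodFun]
  rw [e] at h
  exact h.mfderiv

theorem differential_prodFun_prodVectorField {f : ∀ i, M i → ℝ} {x : ∀ i, M i}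
    (hf : ∀ i, MDifferentiableAt (I i) 𝓘(ℝ, ℝ) (f i) (x i))
    (X : ∀ i, ∀ x : M i, TangentSpace (I i) x) :
    differential (ModelWithCorners.pi I) (prodFun f) x (prodVectorField X x) =
      ∑ i, differential (I i) (f i) (x i) (X i (x i)) := by
  rw [differential_prodFun hf, sum_apply]
  rfl

/-- The covector half of the membership condition in `prodDirac`: the `i`-th inclusion kills every
summand of the differential except the `i`-th. -/
theorem differential_prodFun_comp_tangentIncl {f : ∀ i, M i → ℝ} {x : ∀ i, M i}
    (hf : ∀ i, MDifferentiableAt (I i) 𝓘(ℝ, ℝ) (f i) (x i)) (i : ι) :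
    (differential (ModelWithCorners.pi I) (prodFun f) x).comp (tangentIncl x i) =
      differential (I i) (f i) (x i) := by
  classical
  ext v
  rw [differential_prodFun hf, ContinuousLinearMap.comp_apply, sum_apply,
    Finset.sum_eq_single i]
  · exact congrArg (differential (I i) (f i) (x i)) (Pi.single_eq_same (M := E) i v)
  · intro j _ hj
    exact (congrArg (differential (I j) (f j) (x j)) (Pi.single_eq_of_ne (M := E) hj v)).trans
      (map_zero _)
  · simp

/-- Hamiltonian functions of the factors add up to a Hamiltonian function of the direct product. -/
theorem IsHamiltonian.prod [∀ i, IsManifold (I i) ∞ (M i)]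
    {L : ∀ i, ∀ x : M i, Submodule ℝ (GenTangent (I i) x)}
    {X : ∀ i, ∀ x : M i, TangentSpace (I i) x} {f : ∀ i, M i → ℝ}
    (h : ∀ i, IsHamiltonian (L i) (X i) (f i)) :
    IsHamiltonian (prodDirac L) (prodVectorField X) (prodFun f) := by
  refine ⟨smoothVectorFieldOn_prodVectorField fun i => (h i).1,
    contMDiff_prodFun fun i => (h i).2.1, fun x i => ?_⟩
  rw [differential_prodFun_comp_tangentIncl
    fun i => (h i).2.1.mdifferentiableAt (by simp)]
  exact (h i).2.2 (x i)

end DirectProduct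

/-! ### Differentials and Casimirs on the dual of the Lie algebra. -/

section Dual

variable {𝔤 : Type*} [LieRing 𝔤] [LieAlgebra ℝ 𝔤] [FiniteDimensional ℝ 𝔤]

/-- Lets the Fréchet calculus of the coordinate space be applied to `dualDiff`. -/
theorem fderiv_dualCoords {f : Module.Dual ℝ 𝔤 → ℝ} (hf : SmoothOnDual f)
    (c d : Fin (Module.finrank ℝ 𝔤) → ℝ) :
    fderiv ℝ (fun c => f (dualCoords 𝔤 c)) c d =
      dualCoords 𝔤 d (dualDiff f (dualCoords 𝔤 c)) := by
  rw [dualDiff_spec hf, ← (hf.differentiable (by simp) c).lineDeriv_eq_fderiv]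
  simp [lineDeriv]

theorem dualCoords_symm_apply (ξ : Module.Dual ℝ 𝔤) (j : Fin (Module.finrank ℝ 𝔤)) :
    (dualCoords 𝔤).symm ξ j = ξ (Module.finBasis ℝ 𝔤 j) := by
  simp [dualCoords]

theorem smoothOnDual_eval (v : 𝔤) : SmoothOnDual fun ξ : Module.Dual ℝ 𝔤 => ξ v :=
  (LinearMap.toContinuousLinearMap
    ((LinearMap.applyₗ v).comp (dualCoords 𝔤).toLinearMap)).contDiff

theorem dualDiff_eval (v : 𝔤) (ξ : Module.Dual ℝ 𝔤) :
    dualDiff (fun ξ : Module.Dual ℝ 𝔤 => ξ v) ξ = v := by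
  rw [← sub_eq_zero, ← Module.forall_dual_apply_eq_zero_iff ℝ]
  intro η
  rw [map_sub, dualDiff_spec (smoothOnDual_eval v), sub_eq_zero]
  simp [lineDeriv]

/-- Linear functions suffice as test functions: evaluation at `v` has constant differential `v`. The
conclusion says that `dC` at `ξ` lies in the coadjoint stabiliser of `ξ`. -/
theorem IsCasimir.apply_lie_eq_zero {C : Module.Dual ℝ 𝔤 → ℝ} (hC : IsCasimir C)
    (ξ : Module.Dual ℝ 𝔤) (v : 𝔤) : ξ ⁅dualDiff C ξ, v⁆ = 0 := by
  have h := congrFun (hC.2 _ (smoothOnDual_eval v)) ξ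
  rwa [kks, dualDiff_eval] at h

end Dual

/-! ### Collective functions `C ∘ J`. -/

section Collective

variable {E : Type*} [NormedAddCommGroup E] [NormedSpace ℝ E] {H : Type*} [TopologicalSpace H]
  {I : ModelWithCorners ℝ E H} {M : Type*} [TopologicalSpace M] [ChartedSpace H M]
  {𝔤 : Type*} [LieRing 𝔤] [LieAlgebra ℝ 𝔤] [FiniteDimensional ℝ 𝔤]
  {J : M → Module.Dual ℝ 𝔤} {C : Module.Dual ℝ 𝔤 → ℝ}

theorem contMDiff_dualCoords_symm {n : ℕ∞ω} (hJ : ∀ v, ContMDiff I 𝓘(ℝ, ℝ) n fun x => J x v) :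
    ContMDiff I 𝓘(ℝ, Fin (Module.finrank ℝ 𝔤) → ℝ) n fun x => (dualCoords 𝔤).symm (J x) :=
  contMDiff_pi_space.2 fun j => by simpa only [dualCoords_symm_apply] using hJ _

theorem contMDiff_comp_dual (hC : SmoothOnDual C)
    (hJ : ∀ v, ContMDiff I 𝓘(ℝ, ℝ) ∞ fun x => J x v) :
    ContMDiff I 𝓘(ℝ, ℝ) ∞ fun x => C (J x) := by
  have h := (contMDiff_iff_contDiff.2 hC).comp (contMDiff_dualCoords_symm hJ)
  simpa [Function.comp_def] using h

/-- With `η` a coordinate functional, this gives smoothness of the coefficients of the Hamiltonian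
field of `C ∘ J`. -/
theorem contMDiff_dualDiff_comp (hC : SmoothOnDual C)
    (hJ : ∀ v, ContMDiff I 𝓘(ℝ, ℝ) ∞ fun x => J x v) (η : Module.Dual ℝ 𝔤) :
    ContMDiff I 𝓘(ℝ, ℝ) ∞ fun x => η (dualDiff C (J x)) := by
  have h1 : ContDiff ℝ ∞ fun c =>
      fderiv ℝ (fun c => C (dualCoords 𝔤 c)) c ((dualCoords 𝔤).symm η) :=
    (hC.fderiv_right (m := ∞) (by simp)).clm_apply contDiff_const
  have h := (contMDiff_iff_contDiff.2 h1).comp (contMDiff_dualCoords_symm hJ)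
  simpa [Function.comp_def, fderiv_dualCoords hC] using h

/-- The differential of a collective function `C ∘ J` at `x` is the differential of the component
of `J` along `dC` at `J x`. -/
theorem differential_comp_dual (hC : SmoothOnDual C)
    (hJ : ∀ v, ContMDiff I 𝓘(ℝ, ℝ) ∞ fun x => J x v) (x : M) :
    differential I (fun y => C (J y)) x = differential I (fun y => J y (dualDiff C (J x))) x := by
  have hc : MDifferentiableAt I 𝓘(ℝ, Fin (Module.finrank ℝ 𝔤) → ℝ)
      (fun x => (dualCoords 𝔤).symm (J x)) x :=
    (contMDiff_dualCoords_symm hJ).mdifferentiableAt (by simp)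
  have hD := (hC.differentiable (by simp) ((dualCoords 𝔤).symm (J x))).hasFDerivAt
  have h1 := hD.hasMFDerivAt.comp x hc.hasMFDerivAt
  -- The linear part of `C` at `J x` is its own derivative, so `h1` and `h2` have the same
  -- derivative at `x`.
  have h2 := (fderiv ℝ (fun c => C (dualCoords 𝔤 c))
    ((dualCoords 𝔤).symm (J x))).hasFDerivAt.hasMFDerivAt.comp x hc.hasMFDerivAt
  have e1 : ((fun c => C (dualCoords 𝔤 c)) ∘ fun x => (dualCoords 𝔤).symm (J x)) =
      fun y => C (J y) := by
    ext y
    simp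
  have e2 : (fderiv ℝ (fun c => C (dualCoords 𝔤 c)) ((dualCoords 𝔤).symm (J x)) ∘
      fun x => (dualCoords 𝔤).symm (J x)) = fun y => J y (dualDiff C (J x)) := by
    ext y
    simp [fderiv_dualCoords hC]
  rw [e1] at h1
  rw [e2] at h2
  exact h1.mfderiv.trans h2.mfderiv.symm

/-- If the components of `J` along a basis of `𝔤` have Hamiltonian vector fields `X j`, then the
collective function `C ∘ J` has the Hamiltonian vector field `∑ j, (∂_j C ∘ J) • X j`. -/
theorem IsHamiltonian.comp_dual [IsManifold I ∞ M] {L : ∀ x : M, Submodule ℝ (GenTangent I x)}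
    (hC : SmoothOnDual C) (hJ : ∀ v, ContMDiff I 𝓘(ℝ, ℝ) ∞ fun x => J x v)
    {X : Fin (Module.finrank ℝ 𝔤) → ∀ x : M, TangentSpace I x}
    (hX : ∀ j, IsHamiltonian L (X j) fun x => J x (Module.finBasis ℝ 𝔤 j)) :
    IsHamiltonian L
      (fun x => ∑ j, (Module.finBasis ℝ 𝔤).coord j (dualDiff C (J x)) • X j x)
      fun x => C (J x) := by
  refine ⟨?_, contMDiff_comp_dual hC hJ, fun x => ?_⟩
  · rw [SmoothVectorFieldOn, contMDiffOn_univ]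
    refine ContMDiff.sum_section fun j _ => ContMDiff.smul_section
      (contMDiff_dualDiff_comp hC hJ _) ?_
    exact contMDiffOn_univ.1 (hX j).1
  · have hd : differential I (fun y => C (J y)) x =
        ∑ j, (Module.finBasis ℝ 𝔤).coord j (dualDiff C (J x)) •
          differential I (fun y => J y (Module.finBasis ℝ 𝔤 j)) x := by
      rw [differential_comp_dual hC hJ]
      -- The coefficients are frozen at `x`, so the product rule contributes no derivatives of them.
      have h := HasMFDerivAt.sum (t := Finset.univ) fun j _ =>
        (((hJ (Module.finBasis ℝ 𝔤 j)).mdifferentiableAt (by simp) (x := x)).hasMFDerivAt).const_smul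
          ((Module.finBasis ℝ 𝔤).coord j (dualDiff C (J x)))
      have e : (∑ j, (Module.finBasis ℝ 𝔤).coord j (dualDiff C (J x)) •
          fun y => J y (Module.finBasis ℝ 𝔤 j)) = fun y => J y (dualDiff C (J x)) := by
        ext y
        conv_rhs => rw [← (Module.finBasis ℝ 𝔤).sum_repr (dualDiff C (J x)), map_sum]
        simp
      rw [e] at h
      exact h.mfderiv
    have h := (L x).sum_mem fun j (_ : j ∈ Finset.univ) =>
      (L x).smul_mem ((Module.finBasis ℝ 𝔤).coord j (dualDiff C (J x))) ((hX j).2.2 x)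
    convert h using 1
    rw [Prod.ext_iff, Prod.fst_sum, Prod.snd_sum]
    exact ⟨rfl, hd⟩

end Collective

end DiracGeom

/-! ### The main theorem. -/

theorem mainTheorem6 {k : ℕ} {E : Fin k → Type*} [∀ i, NormedAddCommGroup (E i)]
    [∀ i, NormedSpace ℝ (E i)] [∀ i, FiniteDimensional ℝ (E i)]
    {H : Fin k → Type*} [∀ i, TopologicalSpace (H i)]
    (I : ∀ i, ModelWithCorners ℝ (E i) (H i)) [∀ i, (I i).Boundaryless]
    {M : Fin k → Type*} [∀ i, TopologicalSpace (M i)] [∀ i, ChartedSpace (H i) (M i)]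
    [∀ i, IsManifold (I i) ∞ (M i)]
    [∀ i, T2Space (M i)] [∀ i, ParacompactSpace (M i)] [∀ i, TopologicalSpace.SeparableSpace (M i)]
    {𝔤 : Type*} [LieRing 𝔤] [LieAlgebra ℝ 𝔤] [FiniteDimensional ℝ 𝔤]
    (L : ∀ i, ∀ x : M i, Submodule ℝ (DiracGeom.GenTangent (I i) x))
    (hL : ∀ i, DiracGeom.IsDirac (L i))
    (φ : ∀ i, DiracGeom.HamiltonianAction 𝔤 (L i))
    (C : Module.Dual ℝ 𝔤 → ℝ) (hC : DiracGeom.IsCasimir C) :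
    let F : (∀ i, M i) → ℝ := fun x => DiracGeom.coproduct k C fun i => (φ i).momentum (x i)
    F ∈ DiracGeom.Adm (DiracGeom.prodDirac L) ∧
    ∀ v : 𝔤,
      DiracGeom.prodFun (fun i => (φ i).toLinearMap v) ∈ DiracGeom.Adm (DiracGeom.prodDirac L) ∧
      DiracGeom.poissonBracket (DiracGeom.prodDirac L) F
        (DiracGeom.prodFun fun i => (φ i).toLinearMap v) = 0 ∧
      ∀ X : ∀ i, ∀ x : M i, TangentSpace (I i) x,
        (∀ i, DiracGeom.IsHamiltonian (L i) (X i) ((φ i).toLinearMap v)) →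
          DiracGeom.IsConstantOfMotion (I := ModelWithCorners.pi I)
            (DiracGeom.prodVectorField X) F := by
  intro F
  have iso (i) (x : M i) : DiracGeom.IsIsotropic (L i x) := ((hL i).maximal_isotropic x).prop
  set J : (∀ i, M i) → Module.Dual ℝ 𝔤 := fun x => ∑ i, (φ i).momentum (x i) with hJdef
  have hJ (v : 𝔤) : (fun x => J x v) = DiracGeom.prodFun fun i => (φ i).toLinearMap v := by
    ext x
    simp [hJdef, DiracGeom.prodFun, DiracGeom.HamiltonianAction.momentum]
  choose X hX using fun (v : 𝔤) i => (φ i).mem_adm v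
  have hXJ (v : 𝔤) : DiracGeom.IsHamiltonian (DiracGeom.prodDirac L)
      (DiracGeom.prodVectorField fun i => X v i) fun x => J x v := by
    rw [hJ]
    exact .prod fun i => hX v i
  have hFX := DiracGeom.IsHamiltonian.comp_dual hC.1 (fun v => (hXJ v).2.1)
    fun j => hXJ (Module.finBasis ℝ 𝔤 j)
  have key (v : 𝔤) (Y : ∀ i, ∀ x : M i, TangentSpace (I i) x)
      (hY : ∀ i, DiracGeom.IsHamiltonian (L i) (Y i) ((φ i).toLinearMap v)) (x : ∀ i, M i) :
      DiracGeom.differential (ModelWithCorners.pi I) F x (DiracGeom.prodVectorField Y x) = 0 := by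
    have h0 := hC.apply_lie_eq_zero (J x) v
    -- The bracket is flipped to `⁅v, dC⁆` because `Y i` is a field of `φ i v`, which must be the
    -- first argument of the Poisson bracket.
    rw [← lie_skew, map_neg, neg_eq_zero, show J x _ = _ from congrFun (hJ _) x] at h0
    have hd := DiracGeom.differential_comp_dual hC.1 (fun v => (hXJ v).2.1) x
    rw [hJ] at hd
    refine (congrArg (fun D => D (DiracGeom.prodVectorField Y x)) hd).trans ?_
    rw [DiracGeom.differential_prodFun_prodVectorField
      fun i => (hX _ i).2.1.mdifferentiableAt (by simp), ← neg_eq_zero, ← Finset.sum_neg_distrib,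
      ← h0]
    refine Finset.sum_congr rfl fun i _ => ?_
    change _ = (φ i).toLinearMap _ (x i)
    rw [(φ i).map_lie, DiracGeom.poissonBracket_eq (iso i) (hY i) ((φ i).mem_adm _)]
  refine ⟨⟨_, hFX⟩, fun v => ?_⟩
  have hv : DiracGeom.IsHamiltonian (DiracGeom.prodDirac L)
      (DiracGeom.prodVectorField fun i => X v i)
      (DiracGeom.prodFun fun i => (φ i).toLinearMap v) := .prod fun i => hX v i
  refine ⟨⟨_, hv⟩, ?_, fun Y hY => ⟨hFX.2.1, key v Y hY⟩⟩
  ext x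
  have hiso := DiracGeom.prodDirac_isIsotropic iso
  refine (DiracGeom.poissonBracket_eq hiso hFX ⟨_, hv⟩ x).trans ?_
  -- Pairing the section of `F` with that of `λ(φ(v))` shows that the derivative of each function
  -- along the other's field agrees up to sign; `key` makes one of them zero.
  have h1 := hiso x _ (hFX.2.2 x) _ (hv.2.2 x)
  have h2 := key v _ (hX v) x
  simp only [DiracGeom.pairing] at h1
  change DiracGeom.differential (ModelWithCorners.pi I) (fun x => C (J x)) x _ = 0 at h2
  rw [Pi.zero_apply]
  linarith
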